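/- Let $\mathbb H$ be a complex Hilbert space, let $\Omega$ be a locally compact Hausdorff space with a finite Radon measure $\mu$, and let $0<a\le b$ be real numbers with $1\in[a,b]$. Let $(A_t)_{t\in\Omega}$ be a norm-continuous family of strictly positive bounded operators on $\mathbb H$ such that $\operatorname{Sp}(A_t)\subseteq[a,b]$ for every $t$, and let $(W_t)_{t\in\Omega}$ be a norm-continuous family of positive bounded operators on $\mathbb H$ such that $\int_\Omega\|W_t\|\,d\mu(t)<\infty$. Let $f:[0,\infty)\to[0,\infty)$ be continuous with $f(1)=1$, operator monotone (i.e. $0\le A\le B$ implies $f(A)\le f(B)$ for all bounded operators $A,B$ on every complex Hilbert space) and super-multiplicative (i.e. $f(xy)\ge f(x)f(y)$ for all $x,y\ge0$). Then the Bochner integrals below exist, and $$\int_\Omega W_t^{1/2}f(A_t)W_t^{1/2}\,d\mu(t)\ \otimes_s\ \int_\Omega W_t^{1/2}f(A_t^{-1})W_t^{1/2}\,d\mu(t)\ \le\ \frac{a^2+b^2}{2ab}\Big(\int_\Omega W_t\,d\mu(t)\Big)^{\otimes 2}$$ in the Loewner order on bounded operators on the Hilbert space tensor product $\mathbb H\otimes\mathbb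 H$, where $X\otimes_sY=\frac12(X\otimes Y+Y\otimes X)$ and $X^{\otimes2}=X\otimes X$. -/

import Mathlib

open MeasureTheory
open scoped TensorProduct

universe u v

noncomputable section

/-- The Hilbert space tensor product `H ⊗ H`: the completion of the algebraic tensor product for the
inner product with `⟪x ⊗ y, x' ⊗ y'⟫ = ⟪x, x'⟫ * ⟪y, y'⟫`. -/
abbrev HilbertTensor (H : Type*) [NormedAddCommGroup H] [InnerProductSpace ℂ H] : Type _ :=
  UniformSpace.Completion (H ⊗[ℂ] H)

/-- The tensor product `A ⊗ B` of bounded operators: the continuous extension to `H ⊗ H` of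
`x ⊗ y ↦ A x ⊗ B y`. -/
def opTensor {H : Type*} [NormedAddCommGroup H] [InnerProductSpace ℂ H]
    (A B : H →L[ℂ] H) : HilbertTensor H →L[ℂ] HilbertTensor H :=
  (TensorProduct.mapL A B).completion

/-- The symmetrized tensor product `A ⊗ₛ B = (A ⊗ B + B ⊗ A) / 2`. -/
def symTensor {H : Type*} [NormedAddCommGroup H] [InnerProductSpace ℂ H]
    (A B : H →L[ℂ] H) : HilbertTensor H →L[ℂ] HilbertTensor H :=
  (1 / 2 : ℝ) • (opTensor A B + opTensor B A)

/-- A continuous function `f` on `[0, ∞)` is operator monotone if `0 ≤ A ≤ B` implies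
`f(A) ≤ f(B)` for bounded operators `A`, `B` on an arbitrary complex Hilbert space `K`; the order is
the Loewner order and `f(A)` is the continuous functional calculus. The values of `f` at negative
numbers play no role. -/
def IsOperatorMonotone (f : ℝ → ℝ) : Prop :=
  ContinuousOn f (Set.Ici 0) ∧
    ∀ (K : Type u) [NormedAddCommGroup K] [InnerProductSpace ℂ K] [CompleteSpace K]
      (A B : K →L[ℂ] K), 0 ≤ A → A ≤ B → cfc f A ≤ cfc f B

/-- `f (x y) ≥ f x * f y` for all `x, y ≥ 0`. -/
def IsSuperMultiplicative (f : ℝ → ℝ) : Prop :=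
  ∀ x y : ℝ, 0 ≤ x → 0 ≤ y → f x * f y ≤ f (x * y)

end

/-!
Write `X_t = W_t^{1/2} f(A_t) W_t^{1/2}` and `Y_t = W_t^{1/2} f(A_t⁻¹) W_t^{1/2}`. By bilinearity the
claim follows, after integration in `t` and then in `s`
(`map_integral_mul_map_integral_add_le`), from the pointwise bound
`X_s ⊗ Y_t + Y_s ⊗ X_t ≤ (a / b + b / a) W_s ⊗ W_t`. The left-hand side is the conjugate of
`f(A_s) ⊗ f(A_t⁻¹) + f(A_s⁻¹) ⊗ f(A_t)` by `W_s^{1/2} ⊗ W_t^{1/2}`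
(`map_conjugate_mul_map_conjugate_add_le`), so it suffices to bound the latter operator by the scalar
`a / b + b / a`. As `A_s ⊗ 1` and `1 ⊗ A_t` commute, their joint functional calculus
(`cfc_mul_add_cfc_mul_le_algebraMap`) reduces this to the scalar inequality
`f x f(1/y) + f(1/x) f y ≤ a / b + b / a` for `x, y ∈ [a, b]`.

Super-multiplicativity bounds the left-hand side by `f u + f(1/u)` with `u = x / y`, and it gives
`f u f(1/u) ≤ f 1 = 1`. If `u ≥ 1`, then `1 ≤ f u ≤ u`: the lower bound is monotonicity, the upper
bound is where monotonicity on two-dimensional spaces is needed (`IsOperatorMonotone.le_self`).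
Hence `f u + f(1/u) ≤ f u + 1 / f u ≤ u + 1 / u ≤ a / b + b / a`.

The tensor product enters only through the star homomorphisms `A ↦ A ⊗ 1` and `B ↦ 1 ⊗ B` with
commuting ranges, so the analytic part takes place in abstract C⋆-algebras.
-/

/-! ### Commuting self-adjoint elements of C⋆-algebras -/

open scoped ComplexOrder in
/-- Two-variable functional calculus for commuting self-adjoint elements, in the form of the bound
needed here: `S + i T` is normal, and `f S * g T` is the function `z ↦ f (re z) * g (im z)` of it. -/
theorem cfc_mul_add_cfc_mul_le_algebraMap {𝓐 : Type*} [CStarAlgebra 𝓐] [PartialOrder 𝓐]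
    [StarOrderedRing 𝓐] {S T : 𝓐} (hS : IsSelfAdjoint S) (hT : IsSelfAdjoint T)
    (hST : Commute S T) {f₁ f₂ g₁ g₂ : ℝ → ℝ}
    (hf₁ : ContinuousOn f₁ (spectrum ℝ S)) (hf₂ : ContinuousOn f₂ (spectrum ℝ S))
    (hg₁ : ContinuousOn g₁ (spectrum ℝ T)) (hg₂ : ContinuousOn g₂ (spectrum ℝ T)) {κ : ℝ}
    (h : ∀ x ∈ spectrum ℝ S, ∀ y ∈ spectrum ℝ T, f₁ x * g₁ y + f₂ x * g₂ y ≤ κ) :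
    cfc f₁ S * cfc g₁ T + cfc f₂ S * cfc g₂ T ≤ algebraMap ℝ 𝓐 κ := by
  set N : 𝓐 := S + Complex.I • T with hN
  have hre : (realPart N : 𝓐) = S := by
    simp [hN, hS.coe_realPart, hT.imaginaryPart]
  have him : (imaginaryPart N : 𝓐) = T := by
    simp [hN, hT.coe_realPart, hS.imaginaryPart]
  have hNn : IsStarNormal N := by
    rw [isStarNormal_iff_commute_realPart_imaginaryPart, hre, him]
    exact hST
  have hspec : ∀ z ∈ spectrum ℂ N, z.re ∈ spectrum ℝ S ∧ z.im ∈ spectrum ℝ T := by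
    intro z hz
    constructor
    · rw [← hre, spectrum_realPart' N]; exact ⟨z, hz, rfl⟩
    · rw [← him, spectrum_imaginaryPart' N]; exact ⟨z, hz, rfl⟩
  have cre : ∀ φ : ℝ → ℝ, ContinuousOn φ (spectrum ℝ S) →
      ContinuousOn (fun z : ℂ => (φ z.re : ℂ)) (spectrum ℂ N) := fun φ hφ =>
    Complex.continuous_ofReal.comp_continuousOn
      (hφ.comp Complex.continuous_re.continuousOn fun z hz => (hspec z hz).1)
  have cim : ∀ φ : ℝ → ℝ, ContinuousOn φ (spectrum ℝ T) →
      ContinuousOn (fun z : ℂ => (φ z.im : ℂ)) (spectrum ℂ N) := fun φ hφ =>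
    Complex.continuous_ofReal.comp_continuousOn
      (hφ.comp Complex.continuous_im.continuousOn fun z hz => (hspec z hz).2)
  have e1 : ∀ φ : ℝ → ℝ, ContinuousOn φ (spectrum ℝ S) →
      cfc φ S = cfc (fun z : ℂ => (φ z.re : ℂ)) N := fun φ hφ => by
    rw [cfc_comp_re φ N (by rwa [hre]) hNn, hre]
  have e2 : ∀ φ : ℝ → ℝ, ContinuousOn φ (spectrum ℝ T) →
      cfc φ T = cfc (fun z : ℂ => (φ z.im : ℂ)) N := fun φ hφ => by
    rw [cfc_comp_im φ N (by rwa [him]) hNn, him]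
  rw [e1 f₁ hf₁, e1 f₂ hf₂, e2 g₁ hg₁, e2 g₂ hg₂,
    ← cfc_mul _ _ N (cre f₁ hf₁) (cim g₁ hg₁), ← cfc_mul _ _ N (cre f₂ hf₂) (cim g₂ hg₂),
    ← cfc_add N (fun z : ℂ => (f₁ z.re : ℂ) * g₁ z.im) (fun z : ℂ => (f₂ z.re : ℂ) * g₂ z.im)
      ((cre f₁ hf₁).mul (cim g₁ hg₁)) ((cre f₂ hf₂).mul (cim g₂ hg₂))]
  have : algebraMap ℝ 𝓐 κ = algebraMap ℂ 𝓐 (κ : ℂ) := by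
    rw [IsScalarTower.algebraMap_apply ℝ ℂ 𝓐]; rfl
  rw [this]
  refine cfc_le_algebraMap _ _ _ (fun z hz => ?_)
    (((cre f₁ hf₁).mul (cim g₁ hg₁)).add ((cre f₂ hf₂).mul (cim g₂ hg₂))) hNn
  exact_mod_cast h _ (hspec z hz).1 _ (hspec z hz).2

/-- Star homomorphisms of C⋆-algebras are contractive. -/
theorem StarAlgHom.continuous_of_cstarAlgebra {𝓐 𝓑 : Type*} [CStarAlgebra 𝓑] [CStarAlgebra 𝓐]
    (φ : 𝓑 →⋆ₐ[ℂ] 𝓐) : Continuous φ :=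
  AddMonoidHomClass.continuous_of_bound φ 1 fun S => by
    simpa using NonUnitalStarAlgHom.norm_apply_le φ S

/-- A scalar bound on `spectrum S × spectrum T` gives an operator bound for the images of `S` and
`T` under star homomorphisms with commuting ranges. -/
theorem map_cfc_mul_map_cfc_add_le_algebraMap {𝓐 𝓑 : Type*} [CStarAlgebra 𝓑] [CStarAlgebra 𝓐]
    [PartialOrder 𝓐] [StarOrderedRing 𝓐] (φ ψ : 𝓑 →⋆ₐ[ℂ] 𝓐) (hφψ : ∀ S T, Commute (φ S) (ψ T))
    {S T : 𝓑} (hS : IsSelfAdjoint S) (hT : IsSelfAdjoint T) {f₁ f₂ g₁ g₂ : ℝ → ℝ}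
    (hf₁ : ContinuousOn f₁ (spectrum ℝ S)) (hf₂ : ContinuousOn f₂ (spectrum ℝ S))
    (hg₁ : ContinuousOn g₁ (spectrum ℝ T)) (hg₂ : ContinuousOn g₂ (spectrum ℝ T)) {κ : ℝ}
    (h : ∀ x ∈ spectrum ℝ S, ∀ y ∈ spectrum ℝ T, f₁ x * g₁ y + f₂ x * g₂ y ≤ κ) :
    φ (cfc f₁ S) * ψ (cfc g₁ T) + φ (cfc f₂ S) * ψ (cfc g₂ T) ≤ algebraMap ℝ 𝓐 κ := by
  have hφ : Continuous φ := φ.continuous_of_cstarAlgebra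
  have hψ : Continuous ψ := ψ.continuous_of_cstarAlgebra
  have sS : spectrum ℝ (φ S) ⊆ spectrum ℝ S :=
    AlgHom.spectrum_apply_subset (φ.toAlgHom.restrictScalars ℝ) S
  have sT : spectrum ℝ (ψ T) ⊆ spectrum ℝ T :=
    AlgHom.spectrum_apply_subset (ψ.toAlgHom.restrictScalars ℝ) T
  rw [φ.map_cfc f₁ S hf₁ hφ hS (hS.map φ), φ.map_cfc f₂ S hf₂ hφ hS (hS.map φ),
    ψ.map_cfc g₁ T hg₁ hψ hT (hT.map ψ), ψ.map_cfc g₂ T hg₂ hψ hT (hT.map ψ)]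
  exact cfc_mul_add_cfc_mul_le_algebraMap (hS.map φ) (hT.map ψ) (hφψ S T) (hf₁.mono sS)
    (hf₂.mono sS) (hg₁.mono sT) (hg₂.mono sT) fun x hx y hy => h x (sS hx) y (sT hy)

/-- Since the ranges of `φ` and `ψ` commute, conjugating by `R` and `R'` inside amounts to
conjugating by the self-adjoint element `φ R * ψ R'` outside, which preserves the order. -/
theorem map_conjugate_mul_map_conjugate_add_le {𝓐 𝓑 : Type*} [CStarAlgebra 𝓑] [CStarAlgebra 𝓐]
    [PartialOrder 𝓐] [StarOrderedRing 𝓐] (φ ψ : 𝓑 →⋆ₐ[ℂ] 𝓐) (hφψ : ∀ S T, Commute (φ S) (ψ T))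
    {R R' S₁ S₂ T₁ T₂ : 𝓑} (hR : IsSelfAdjoint R) (hR' : IsSelfAdjoint R') {c : ℝ}
    (h : φ S₁ * ψ T₁ + φ S₂ * ψ T₂ ≤ algebraMap ℝ 𝓐 c) :
    φ (R * S₁ * R) * ψ (R' * T₁ * R') + φ (R * S₂ * R) * ψ (R' * T₂ * R') ≤
      c • (φ (R * R) * ψ (R' * R')) := by
  have hC : IsSelfAdjoint (φ R * ψ R') := by
    rw [IsSelfAdjoint, star_mul, (hR.map φ).star_eq, (hR'.map ψ).star_eq, (hφψ R R').eq]
  have hmul : ∀ S T : 𝓑, φ (R * S * R) * ψ (R' * T * R') =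
      φ R * ψ R' * (φ S * ψ T) * (φ R * ψ R') := fun S T => by
    rw [(hφψ S R').symm.mul_mul_mul_comm, ← map_mul, ← map_mul,
      (hφψ R (R' * T)).symm.mul_mul_mul_comm, ← map_mul, ← map_mul]
  have := hC.conjugate_le_conjugate h
  rw [mul_add, add_mul, ← hmul, ← hmul, Algebra.algebraMap_eq_smul_one] at this
  refine this.trans_eq ?_
  have h1 := hmul 1 1
  simp only [map_one, mul_one] at h1
  rw [mul_smul_comm, smul_mul_assoc, mul_one, h1]

/-! ### Bilinear integral inequalities -/

/-- A pointwise inequality in `(s, t)` between the bilinear expressions may be integrated in `t` and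
then in `s`; this replaces Fubini's theorem on the product space. -/
theorem map_integral_mul_map_integral_add_le {Ω 𝓐 𝓑 : Type*} [MeasurableSpace Ω] {μ : Measure Ω}
    [CStarAlgebra 𝓑] [CStarAlgebra 𝓐] [PartialOrder 𝓐] [StarOrderedRing 𝓐] (φ ψ : 𝓑 →⋆ₐ[ℂ] 𝓐)
    {X Y Z : Ω → 𝓑} (hX : Integrable X μ) (hY : Integrable Y μ) (hZ : Integrable Z μ) {c : ℝ}
    (h : ∀ s t, φ (X s) * ψ (Y t) + φ (Y s) * ψ (X t) ≤ c • (φ (Z s) * ψ (Z t))) :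
    φ (∫ t, X t ∂μ) * ψ (∫ t, Y t ∂μ) + φ (∫ t, Y t ∂μ) * ψ (∫ t, X t ∂μ) ≤
      c • (φ (∫ t, Z t ∂μ) * ψ (∫ t, Z t ∂μ)) := by
  let L : (𝓑 →⋆ₐ[ℂ] 𝓐) → 𝓑 →L[ℂ] 𝓐 := fun θ =>
    ⟨θ.toAlgHom.toLinearMap, θ.continuous_of_cstarAlgebra⟩
  have hint : ∀ (θ : 𝓑 →⋆ₐ[ℂ] 𝓐) {V : Ω → 𝓑}, Integrable V μ → Integrable (fun t => θ (V t)) μ :=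
    fun θ _ hV => (L θ).integrable_comp hV
  have hcomm : ∀ (θ : 𝓑 →⋆ₐ[ℂ] 𝓐) {V : Ω → 𝓑}, Integrable V μ →
      ∫ t, θ (V t) ∂μ = θ (∫ t, V t ∂μ) :=
    fun θ _ hV => (L θ).integral_comp_comm hV
  have h1 : ∀ s, φ (X s) * ψ (∫ t, Y t ∂μ) + φ (Y s) * ψ (∫ t, X t ∂μ) ≤
      c • (φ (Z s) * ψ (∫ t, Z t ∂μ)) := by
    intro s
    have := integral_mono (((hint ψ hY).const_mul (φ (X s))).add ((hint ψ hX).const_mul (φ (Y s))))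
      (((hint ψ hZ).const_mul (φ (Z s))).smul c) (h s)
    simp only [Pi.add_apply, Pi.smul_apply] at this
    rwa [integral_add ((hint ψ hY).const_mul _) ((hint ψ hX).const_mul _), integral_smul,
      integral_const_mul_of_integrable (hint ψ hY), integral_const_mul_of_integrable (hint ψ hX),
      integral_const_mul_of_integrable (hint ψ hZ), hcomm ψ hX, hcomm ψ hY, hcomm ψ hZ] at this
  have := integral_mono (((hint φ hX).mul_const (ψ (∫ t, Y t ∂μ))).add
    ((hint φ hY).mul_const (ψ (∫ t, X t ∂μ))))
    (((hint φ hZ).mul_const (ψ (∫ t, Z t ∂μ))).smul c) h1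
  simp only [Pi.add_apply, Pi.smul_apply] at this
  rwa [integral_add ((hint φ hX).mul_const _) ((hint φ hY).mul_const _), integral_smul,
    integral_mul_const_of_integrable (hint φ hX), integral_mul_const_of_integrable (hint φ hY),
    integral_mul_const_of_integrable (hint φ hZ), hcomm φ hX, hcomm φ hY, hcomm φ hZ] at this

/-- The integral inequality for two star homomorphisms with commuting ranges in place of
`A ↦ A ⊗ 1` and `B ↦ 1 ⊗ B`. -/
theorem half_smul_map_integral_add_le {Ω 𝓐 𝓑 : Type*} [MeasurableSpace Ω] {μ : Measure Ω}
    [CStarAlgebra 𝓑] [PartialOrder 𝓑] [StarOrderedRing 𝓑] [CStarAlgebra 𝓐] [PartialOrder 𝓐]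
    [StarOrderedRing 𝓐] (φ ψ : 𝓑 →⋆ₐ[ℂ] 𝓐) (hφψ : ∀ S T, Commute (φ S) (ψ T))
    {A W : Ω → 𝓑} (hA : ∀ t, IsSelfAdjoint (A t)) {K : Set ℝ} (hAK : ∀ t, spectrum ℝ (A t) ⊆ K)
    (hWpos : ∀ t, 0 ≤ W t) (hW : Integrable W μ) {f g : ℝ → ℝ} (hf : ContinuousOn f K)
    (hg : ContinuousOn g K)
    (hX : Integrable (fun t => CFC.sqrt (W t) * cfc f (A t) * CFC.sqrt (W t)) μ)
    (hY : Integrable (fun t => CFC.sqrt (W t) * cfc g (A t) * CFC.sqrt (W t)) μ) {c : ℝ}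
    (h : ∀ x ∈ K, ∀ y ∈ K, f x * g y + g x * f y ≤ c) :
    (1 / 2 : ℝ) • (φ (∫ t, CFC.sqrt (W t) * cfc f (A t) * CFC.sqrt (W t) ∂μ) *
          ψ (∫ t, CFC.sqrt (W t) * cfc g (A t) * CFC.sqrt (W t) ∂μ) +
        φ (∫ t, CFC.sqrt (W t) * cfc g (A t) * CFC.sqrt (W t) ∂μ) *
          ψ (∫ t, CFC.sqrt (W t) * cfc f (A t) * CFC.sqrt (W t) ∂μ)) ≤
      (1 / 2 * c) • (φ (∫ t, W t ∂μ) * ψ (∫ t, W t ∂μ)) := by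
  have hsq : ∀ t, CFC.sqrt (W t) * CFC.sqrt (W t) = W t :=
    fun t => CFC.sqrt_mul_sqrt_self (W t) (hWpos t)
  rw [mul_smul]
  refine smul_le_smul_of_nonneg_left
    (map_integral_mul_map_integral_add_le φ ψ hX hY hW fun s t => ?_) (by norm_num)
  have hst := map_conjugate_mul_map_conjugate_add_le φ ψ hφψ
    (CFC.sqrt_nonneg (W s)).isSelfAdjoint (CFC.sqrt_nonneg (W t)).isSelfAdjoint
    (map_cfc_mul_map_cfc_add_le_algebraMap φ ψ hφψ (hA s) (hA t)
      (hf.mono (hAK s)) (hg.mono (hAK s)) (hg.mono (hAK t)) (hf.mono (hAK t))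
      fun x hx y hy => h x (hAK s hx) y (hAK t hy))
  rwa [hsq, hsq] at hst

/-! ### Measurability and integrability -/

/-- Neither `Ω` nor `E` need be second countable: up to a null set `Ω` is a countable union of
compact sets by regularity, and a continuous image of a compact set is separable. -/
theorem Continuous.aestronglyMeasurable_of_regular {Ω E : Type*} [TopologicalSpace Ω] [T2Space Ω]
    [MeasurableSpace Ω] [BorelSpace Ω] [TopologicalSpace E]
    [TopologicalSpace.PseudoMetrizableSpace E] {μ : Measure Ω} [IsFiniteMeasure μ] [μ.Regular]
    {F : Ω → E} (hF : Continuous F) :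
    AEStronglyMeasurable F μ := by
  have hK : ∀ n : ℕ, ∃ K : Set Ω, IsCompact K ∧ μ Set.univ < μ K + ((n : ENNReal) + 1)⁻¹ := by
    intro n
    obtain ⟨K, -, hK, h⟩ := MeasurableSet.univ.exists_isCompact_lt_add (measure_ne_top μ _)
      (ε := ((n : ENNReal) + 1)⁻¹) (by simp)
    exact ⟨K, hK, h⟩
  choose K hK hlt using hK
  have hnull : μ (⋃ n, K n)ᶜ = 0 := by
    by_contra hne
    obtain ⟨n, hn⟩ := ENNReal.exists_inv_nat_lt hne
    have hm : MeasurableSet (⋃ n, K n) := .iUnion fun n => (hK n).measurableSet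
    have h1 := measure_add_measure_compl (μ := μ) hm
    have h2 : μ (K n) ≤ μ (⋃ n, K n) := measure_mono (Set.subset_iUnion K n)
    have h3 : ((n : ENNReal) + 1)⁻¹ ≤ μ (⋃ n, K n)ᶜ :=
      (ENNReal.inv_le_inv.2 (le_add_of_nonneg_right zero_le_one)).trans hn.le
    exact absurd (hlt n) (not_lt.2 (h1 ▸ add_le_add h2 h3))
  have hres : μ.restrict (⋃ n, K n) = μ := by
    rw [Measure.restrict_eq_self_of_ae_mem]
    exact mem_ae_iff.2 hnull
  rw [← hres, aestronglyMeasurable_iUnion_iff]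
  exact fun n => hF.continuousOn.aestronglyMeasurable_of_isCompact (hK n) (hK n).measurableSet

theorem Continuous.cfcSqrt {Ω 𝓑 : Type*} [TopologicalSpace Ω] [CStarAlgebra 𝓑] [PartialOrder 𝓑]
    [StarOrderedRing 𝓑] {W : Ω → 𝓑} (hW : Continuous W) (hWpos : ∀ t, 0 ≤ W t) :
    Continuous fun t => CFC.sqrt (W t) := by
  simp only [CFC.sqrt_eq_cfc]
  exact Continuous.cfc_nnreal_of_mem_nhdsSet (s := Set.univ) _ Filter.univ_mem hW hWpos
    NNReal.continuous_sqrt.continuousOn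

theorem integrable_sqrt_mul_cfc_mul_sqrt {Ω 𝓑 : Type*} [TopologicalSpace Ω] [T2Space Ω]
    [MeasurableSpace Ω] [BorelSpace Ω] {μ : Measure Ω} [IsFiniteMeasure μ] [μ.Regular]
    [CStarAlgebra 𝓑] [PartialOrder 𝓑] [StarOrderedRing 𝓑] {A W : Ω → 𝓑} (hA : Continuous A)
    (hAsa : ∀ t, IsSelfAdjoint (A t)) {K : Set ℝ} (hK : IsCompact K)
    (hAK : ∀ t, spectrum ℝ (A t) ⊆ K) (hW : Continuous W) (hWpos : ∀ t, 0 ≤ W t)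
    (hWint : Integrable (fun t => ‖W t‖) μ) {g : ℝ → ℝ} (hg : ContinuousOn g K) :
    Integrable (fun t => CFC.sqrt (W t) * cfc g (A t) * CFC.sqrt (W t)) μ := by
  obtain ⟨M, hM⟩ := hK.exists_bound_of_continuousOn hg
  have hsqrt := hW.cfcSqrt hWpos
  have hcont : Continuous fun t => CFC.sqrt (W t) * cfc g (A t) * CFC.sqrt (W t) :=
    (hsqrt.mul (hA.cfc' hK g hAK hg hAsa)).mul hsqrt
  refine (hWint.mul_const (max M 0)).mono' hcont.aestronglyMeasurable_of_regular
    (ae_of_all _ fun t => ?_)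
  have hs : ‖CFC.sqrt (W t)‖ * ‖CFC.sqrt (W t)‖ = ‖W t‖ := by
    rw [← CStarRing.norm_star_mul_self, (CFC.sqrt_nonneg (W t)).isSelfAdjoint.star_eq,
      CFC.sqrt_mul_sqrt_self (W t) (hWpos t)]
  have hb : ‖cfc g (A t)‖ ≤ max M 0 := norm_cfc_le (le_max_right _ _) fun x hx =>
    (hM x (hAK t hx)).trans (le_max_left _ _)
  calc _ ≤ ‖CFC.sqrt (W t)‖ * ‖cfc g (A t)‖ * ‖CFC.sqrt (W t)‖ := norm_mul₃_le
    _ = ‖W t‖ * ‖cfc g (A t)‖ := by rw [mul_right_comm, hs]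
    _ ≤ ‖W t‖ * max M 0 := by gcongr

theorem cfc_ringInverse {𝓑 : Type*} [CStarAlgebra 𝓑] {S : 𝓑} (hS : IsSelfAdjoint S)
    (hu : IsUnit S) (f : ℝ → ℝ) (hf : ContinuousOn f ((fun x => x⁻¹) '' spectrum ℝ S)) :
    cfc f (Ring.inverse S) = cfc (fun x => f x⁻¹) S := by
  have hinv : ContinuousOn (fun x : ℝ => x⁻¹) (spectrum ℝ S) :=
    continuousOn_id.inv₀ fun x hx => spectrum.ne_zero_of_mem_of_unit (a := hu.unit) hx
  rw [← cfc_ringInverse_id (R := ℝ) S hu hS, ← cfc_comp' f (fun x => x⁻¹) S hf hinv]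

/-! ### Scalar consequences of operator monotonicity -/

/-- Operator monotonicity for scalar operators on a one-dimensional space. -/
theorem IsOperatorMonotone.monotoneOn {f : ℝ → ℝ} (hf : IsOperatorMonotone.{u} f) :
    MonotoneOn f (Set.Ici 0) := by
  intro x hx y _ hxy
  have hx : 0 ≤ x := hx
  -- `ULift` puts the one-dimensional space into the universe of the hypothesis.
  let K := EuclideanSpace ℂ (ULift.{u} (Fin 1))
  have := hf.2 K (algebraMap ℝ _ x) (algebraMap ℝ _ y) (algebraMap_nonneg _ hx)
    (algebraMap_mono _ hxy)
  rw [cfc_algebraMap, cfc_algebraMap] at this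
  exact (algebraMap_le_algebraMap).1 this

theorem cfc_smul_add_smul_one_sub_of_isStarProjection {𝓐 : Type*} [CStarAlgebra 𝓐] {P : 𝓐}
    (hP : IsStarProjection P) (f : ℝ → ℝ) (α β : ℝ) :
    cfc f (α • P + β • (1 - P)) = f α • P + f β • (1 - P) := by
  have hsa := hP.isSelfAdjoint
  have hfin := hP.isIdempotentElem.finite_spectrum ℝ
  have key : ∀ x y : ℝ, x • P + y • (1 - P) = cfc (fun t => x * t + y * (1 - t)) P := by
    intro x y
    rw [cfc_add P _ _, cfc_const_mul _ _ P, cfc_const_mul _ _ P, cfc_sub _ _ P,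
      cfc_const_one ℝ P, cfc_id' ℝ P]
  rw [key, key, ← cfc_comp' f _ P ((hfin.image _).continuousOn _)]
  refine cfc_congr fun t ht => ?_
  rcases hP.isIdempotentElem.spectrum_subset ℝ ht with h | h
  · simp [h]
  · simp [Set.mem_singleton_iff.1 h]

/-- An operator monotone function with `f 1 = 1` lies below the identity on `[1, ∞)`. If `x p < 1`,
let `P` be the projection onto `v = √p e + √(1 - p) e'` in a two-dimensional space. Then
`x P ≤ diag(1, β)` for `β` large, and the `e`-diagonal entries of `f (x P) ≤ f (diag(1, β))` give
`f x * p ≤ 1`. Letting `p` tend to `1 / x` gives the claim. -/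
theorem IsOperatorMonotone.le_self {f : ℝ → ℝ} (hf : IsOperatorMonotone.{u} f)
    (hf0 : ∀ x, 0 ≤ x → 0 ≤ f x) (hf1 : f 1 = 1) {x : ℝ} (hx : 1 ≤ x) : f x ≤ x := by
  suffices h : ∀ p : ℝ, 0 < p → p < 1 → x * p < 1 → f x * p ≤ 1 by
    by_contra! hlt
    have hx0 : 0 < x := by linarith
    obtain ⟨p, hp, hp'⟩ := exists_between (inv_strictAnti₀ hx0 hlt)
    have hfx : 0 < f x := hx0.trans hlt
    have hp0 : 0 < p := (inv_pos.2 hfx).trans hp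
    refine absurd (h p hp0 (hp'.trans_le (inv_le_one_of_one_le₀ hx)) ?_) (not_le.2 ?_)
    · rwa [lt_inv_comm₀ hp0 hx0, ← one_div, lt_div_iff₀ hp0] at hp'
    · rwa [inv_lt_iff_one_lt_mul₀ hfx, mul_comm] at hp
  intro p hp0 hp1 hxp
  let K := EuclideanSpace ℂ (ULift.{u} (Fin 2))
  let v : K := WithLp.toLp 2 fun i => if i.down = 0 then (√p : ℂ) else (√(1 - p) : ℂ)
  let e : K := WithLp.toLp 2 fun i => if i.down = 0 then 1 else 0
  have sum2 : ∀ {M : Type} [AddCommMonoid M] (g : ULift.{u} (Fin 2) → M),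
      ∑ i, g i = g ⟨0⟩ + g ⟨1⟩ := fun g => by
    rw [← Equiv.ulift.symm.sum_comp, Fin.sum_univ_two]; rfl
  have sp : √p ^ 2 = p := Real.sq_sqrt hp0.le
  have sq : √(1 - p) ^ 2 = 1 - p := Real.sq_sqrt (by linarith)
  have hv : ‖v‖ = 1 := by
    rw [EuclideanSpace.norm_eq, sum2]
    simp [v, abs_of_nonneg, Real.sqrt_nonneg, sp, sq]
  have he : ‖e‖ = 1 := by
    rw [EuclideanSpace.norm_eq, sum2]
    simp [e]
  have iv : ∀ z : K, inner ℂ v z = √p * z ⟨0⟩ + √(1 - p) * z ⟨1⟩ := fun z => by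
    rw [PiLp.inner_apply, sum2]; simp [v, mul_comm]
  have ie : ∀ z : K, inner ℂ e z = z ⟨0⟩ := fun z => by
    rw [PiLp.inner_apply, sum2]; simp [e]
  let P := InnerProductSpace.rankOne ℂ v v
  let Q := InnerProductSpace.rankOne ℂ e e
  have hP : IsStarProjection P := InnerProductSpace.isStarProjection_rankOne_self hv
  have hQ : IsStarProjection Q := InnerProductSpace.isStarProjection_rankOne_self he
  -- The least `β` with `x P ≤ Q + β (1 - Q)`: the difference is then singular, and its quadratic
  -- form at `z` is at least the perfect square in `‖z 0‖` and `‖z 1‖` of `e1` below.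
  obtain ⟨β, hβ⟩ : ∃ β : ℝ, β = x * (1 - p) / (1 - x * p) := ⟨_, rfl⟩
  have hA : 0 ≤ x • P + (0 : ℝ) • (1 - P) := by
    rw [zero_smul, add_zero]
    exact smul_nonneg (by linarith) hP.nonneg
  have hAB : x • P + (0 : ℝ) • (1 - P) ≤ (1 : ℝ) • Q + β • (1 - Q) := by
    rw [ContinuousLinearMap.le_def, ContinuousLinearMap.isPositive_def']
    refine ⟨?_, fun z => ?_⟩
    · rw [zero_smul, add_zero, one_smul]
      exact (hQ.isSelfAdjoint.add (.smul (.all β) hQ.one_sub.isSelfAdjoint)).sub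
        (.smul (.all x) hP.isSelfAdjoint)
    have key : ((1 : ℝ) • Q + β • (1 - Q) - (x • P + (0 : ℝ) • (1 - P))).reApplyInnerSelf z =
        ‖z ⟨0⟩‖ ^ 2 + β * ‖z ⟨1⟩‖ ^ 2 - x * ‖√p * z ⟨0⟩ + √(1 - p) * z ⟨1⟩‖ ^ 2 := by
      have hPz : RCLike.re (inner ℂ (P z) z) = ‖√p * z ⟨0⟩ + √(1 - p) * z ⟨1⟩‖ ^ 2 := by
        rw [← iv, InnerProductSpace.rankOne_apply, inner_smul_left, RCLike.conj_mul]
        norm_cast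
      have hQz : RCLike.re (inner ℂ (Q z) z) = ‖z ⟨0⟩‖ ^ 2 := by
        rw [← ie, InnerProductSpace.rankOne_apply, inner_smul_left, RCLike.conj_mul]
        norm_cast
      have hz : RCLike.re (inner ℂ z z) = ‖z ⟨0⟩‖ ^ 2 + ‖z ⟨1⟩‖ ^ 2 := by
        rw [inner_self_eq_norm_sq, EuclideanSpace.norm_sq_eq, sum2]
      rw [ContinuousLinearMap.reApplyInnerSelf_apply]
      simp only [zero_smul, add_zero, one_smul, sub_apply, add_apply, smul_apply,
        one_apply_eq_self]
      simp only [inner_sub_left, inner_add_left, RCLike.real_smul_eq_coe_smul (K := ℂ),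
        inner_smul_left, RCLike.conj_ofReal, map_sub, map_add, RCLike.re_ofReal_mul, hPz, hQz, hz]
      ring
    rw [key]
    have h1xp : 0 < 1 - x * p := by linarith
    have hn : ‖√p * z ⟨0⟩ + √(1 - p) * z ⟨1⟩‖ ≤ √p * ‖z ⟨0⟩‖ + √(1 - p) * ‖z ⟨1⟩‖ := by
      refine (norm_add_le _ _).trans_eq ?_
      simp [abs_of_nonneg, Real.sqrt_nonneg]
    generalize ‖z ⟨0⟩‖ = r at *
    generalize ‖z ⟨1⟩‖ = s at *
    have hn2 := pow_le_pow_left₀ (norm_nonneg _) hn 2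
    have hx0 : 0 ≤ x := by linarith
    have : 0 ≤ r ^ 2 + β * s ^ 2 - x * (√p * r + √(1 - p) * s) ^ 2 := by
      have e1 : r ^ 2 + β * s ^ 2 - x * (√p * r + √(1 - p) * s) ^ 2 =
          ((1 - x * p) * r - x * √p * √(1 - p) * s) ^ 2 / (1 - x * p) := by
        rw [hβ, eq_div_iff h1xp.ne']
        field_simp
        ring_nf
        rw [sp, sq]
        ring
      rw [e1]
      positivity
    linarith [mul_le_mul_of_nonneg_left hn2 hx0]
  have h1 := hf.2 K _ _ hA hAB
  rw [cfc_smul_add_smul_one_sub_of_isStarProjection hP,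
    cfc_smul_add_smul_one_sub_of_isStarProjection hQ, hf1] at h1
  rw [ContinuousLinearMap.le_def] at h1
  have h2 := h1.re_inner_nonneg_right e
  have hQe : Q e = e := by
    rw [InnerProductSpace.rankOne_apply, inner_self_eq_norm_sq_to_K, he]; simp
  have hPe : RCLike.re (inner ℂ e (P e)) = p := by
    rw [InnerProductSpace.rankOne_apply, inner_smul_right, ← inner_conj_symm, RCLike.conj_mul, ie]
    simp [v]
    rw [abs_of_nonneg (Real.sqrt_nonneg p), ← Complex.ofReal_pow, Complex.ofReal_re, sp]
  simp only [hQe, one_smul, sub_apply, add_apply, smul_apply, one_apply_eq_self, sub_self,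
    smul_zero, add_zero] at h2
  simp only [inner_sub_right, inner_add_right, RCLike.real_smul_eq_coe_smul (K := ℂ),
    inner_smul_right, map_sub, map_add, RCLike.re_ofReal_mul, hPe, inner_self_eq_norm_sq, he] at h2
  -- The entry of `f (x P)` is `f x * p + f 0 * (1 - p)`, whose second term is nonnegative.
  nlinarith [hf0 0 le_rfl]

/-- The function `u ↦ u + u⁻¹` is maximal on `[w⁻¹, w]` at the end points. -/
theorem add_inv_le_add_inv {u w : ℝ} (hu : 0 < u) (h₁ : u ≤ w) (h₂ : u⁻¹ ≤ w) :
    u + u⁻¹ ≤ w + w⁻¹ := by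
  have hw : 0 < w := hu.trans_le h₁
  have huw : 1 ≤ u * w := by
    rwa [inv_le_iff_one_le_mul₀ hu, mul_comm] at h₂
  have : w + w⁻¹ - (u + u⁻¹) = (w - u) * (u * w - 1) / (u * w) := by field_simp; ring
  have : 0 ≤ (w - u) * (u * w - 1) / (u * w) :=
    div_nonneg (mul_nonneg (by linarith) (by linarith)) (by positivity)
  linarith

section
variable {f : ℝ → ℝ} (hf0 : ∀ x, 0 ≤ x → 0 ≤ f x) (hf1 : f 1 = 1)
  (hfmono : IsOperatorMonotone.{u} f) (hfmul : IsSuperMultiplicative f)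
include hf0 hf1 hfmono hfmul

/-- For `x ≥ 1`, `1 ≤ f x ≤ x` and `f x⁻¹ ≤ (f x)⁻¹`, so that `u ↦ u + u⁻¹` may be compared at
`f x` and `x`. -/
theorem apply_add_apply_inv_le {x : ℝ} (hx : 0 < x) : f x + f x⁻¹ ≤ x + x⁻¹ := by
  wlog h : 1 ≤ x generalizing x
  · have := this (inv_pos.2 hx) ((one_le_inv₀ hx).2 (le_of_not_ge h))
    rw [inv_inv] at this
    linarith
  have hp1 : 1 ≤ f x := hf1 ▸ hfmono.monotoneOn (Set.mem_Ici.2 zero_le_one) hx.le h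
  have hpx : f x ≤ x := hfmono.le_self hf0 hf1 h
  have hpq : f x * f x⁻¹ ≤ 1 := by
    have := hfmul x x⁻¹ hx.le (inv_pos.2 hx).le
    rwa [mul_inv_cancel₀ hx.ne', hf1] at this
  have hp0 : 0 < f x := by linarith
  have hq : f x⁻¹ ≤ (f x)⁻¹ := by
    rwa [← one_div (f x), le_div_iff₀' hp0]
  have := add_inv_le_add_inv hp0 hpx ((inv_le_one_of_one_le₀ hp1).trans h)
  linarith

/-- Super-multiplicativity bounds the left-hand side by `f u + f u⁻¹`, where `u = x / y` lies in
`[a / b, b / a]`. -/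
theorem apply_mul_apply_inv_add_le {a b x y : ℝ} (ha : 0 < a) (hx : x ∈ Set.Icc a b)
    (hy : y ∈ Set.Icc a b) : f x * f y⁻¹ + f x⁻¹ * f y ≤ (a ^ 2 + b ^ 2) / (a * b) := by
  have hx0 : 0 < x := ha.trans_le hx.1
  have hy0 : 0 < y := ha.trans_le hy.1
  have hb : 0 < b := hx0.trans_le hx.2
  have h1 := hfmul x y⁻¹ hx0.le (inv_pos.2 hy0).le
  have h2 := hfmul x⁻¹ y (inv_pos.2 hx0).le hy0.le
  have hinv : x⁻¹ * y = (x * y⁻¹)⁻¹ := by rw [mul_inv, inv_inv]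
  have hu : 0 < x * y⁻¹ := by positivity
  have h3 := apply_add_apply_inv_le hf0 hf1 hfmono hfmul hu
  have h4 : x * y⁻¹ + (x * y⁻¹)⁻¹ ≤ b / a + (b / a)⁻¹ := by
    refine add_inv_le_add_inv hu ?_ ?_
    · rw [← div_eq_mul_inv]; exact div_le_div₀ hb.le hx.2 ha hy.1
    · rw [← hinv, mul_comm, ← div_eq_mul_inv]; exact div_le_div₀ hb.le hy.2 ha hx.1
  have h5 : b / a + (b / a)⁻¹ = (a ^ 2 + b ^ 2) / (a * b) := by field_simp; ring
  rw [hinv] at h2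
  linarith

end

/-! ### Tensor products of operators -/

section HilbertTensor
variable {H : Type*} [NormedAddCommGroup H] [InnerProductSpace ℂ H]

/-- Bounded operators on `H ⊗ H` that agree on elementary tensors are equal. -/
theorem HilbertTensor.clm_ext {E : Type*} [NormedAddCommGroup E] [NormedSpace ℂ E]
    {S T : HilbertTensor H →L[ℂ] E}
    (h : ∀ x y : H, S ((x ⊗ₜ[ℂ] y : H ⊗[ℂ] H) : HilbertTensor H) = T ((x ⊗ₜ[ℂ] y : H ⊗[ℂ] H))) :
    S = T := by
  ext z
  induction z using UniformSpace.Completion.induction_on with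
  | hp => exact isClosed_eq S.continuous T.continuous
  | ih z =>
    induction z with
    | zero => rw [UniformSpace.Completion.coe_zero, map_zero, map_zero]
    | tmul x y => exact h x y
    | add x y hx hy => simp only [UniformSpace.Completion.coe_add, map_add, hx, hy]

@[simp]
theorem opTensor_tmul (A B : H →L[ℂ] H) (x y : H) :
    opTensor A B ((x ⊗ₜ[ℂ] y : H ⊗[ℂ] H) : HilbertTensor H) = ((A x ⊗ₜ[ℂ] B y : H ⊗[ℂ] H)) := by
  simp [opTensor]

theorem opTensor_add_left (A A' B : H →L[ℂ] H) :
    opTensor (A + A') B = opTensor A B + opTensor A' B :=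
  HilbertTensor.clm_ext fun x y => by
    simp [TensorProduct.add_tmul, UniformSpace.Completion.coe_add]

theorem opTensor_add_right (A B B' : H →L[ℂ] H) :
    opTensor A (B + B') = opTensor A B + opTensor A B' :=
  HilbertTensor.clm_ext fun x y => by
    simp [TensorProduct.tmul_add, UniformSpace.Completion.coe_add]

theorem opTensor_smul_left (c : ℂ) (A B : H →L[ℂ] H) :
    opTensor (c • A) B = c • opTensor A B :=
  HilbertTensor.clm_ext fun x y => by
    simp [← TensorProduct.smul_tmul', UniformSpace.Completion.coe_smul]

theorem opTensor_smul_right (c : ℂ) (A B : H →L[ℂ] H) :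
    opTensor A (c • B) = c • opTensor A B :=
  HilbertTensor.clm_ext fun x y => by
    simp [UniformSpace.Completion.coe_smul]

theorem opTensor_mul (A A' B B' : H →L[ℂ] H) :
    opTensor (A * A') (B * B') = opTensor A B * opTensor A' B' :=
  HilbertTensor.clm_ext fun x y => by simp

theorem opTensor_one : opTensor (1 : H →L[ℂ] H) 1 = 1 :=
  HilbertTensor.clm_ext fun x y => by simp

theorem star_opTensor [CompleteSpace H] (A B : H →L[ℂ] H) :
    star (opTensor A B) = opTensor (star A) (star B) := by
  rw [ContinuousLinearMap.star_eq_adjoint, eq_comm, ContinuousLinearMap.eq_adjoint_iff]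
  intro z w
  induction z, w using UniformSpace.Completion.induction_on₂ with
  | hp => exact isClosed_eq (by fun_prop) (by fun_prop)
  | ih z w =>
    simp only [opTensor, ContinuousLinearMap.completion_apply_coe,
      UniformSpace.Completion.inner_coe]
    induction z with
    | zero => simp
    | add x y hx hy => simp only [map_add, inner_add_left, hx, hy]
    | tmul x y =>
      induction w with
      | zero => simp
      | add x y hx hy => simp only [map_add, inner_add_right, hx, hy]
      | tmul x' y' =>
        simp [ContinuousLinearMap.star_eq_adjoint, ContinuousLinearMap.adjoint_inner_left]

theorem opTensor_zero_left (B : H →L[ℂ] H) : opTensor 0 B = 0 := by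
  simpa using opTensor_smul_left 0 0 B

theorem opTensor_zero_right (A : H →L[ℂ] H) : opTensor A 0 = 0 := by
  simpa using opTensor_smul_right 0 A 0

variable [CompleteSpace H]

/-- The embedding `A ↦ A ⊗ 1` as a star homomorphism. -/
noncomputable def opTensorLeft (H : Type*) [NormedAddCommGroup H] [InnerProductSpace ℂ H]
    [CompleteSpace H] : (H →L[ℂ] H) →⋆ₐ[ℂ] (HilbertTensor H →L[ℂ] HilbertTensor H) where
  toFun A := opTensor A 1
  map_one' := opTensor_one
  map_mul' A B := by rw [← opTensor_mul, one_mul]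
  map_zero' := opTensor_zero_left 1
  map_add' A B := opTensor_add_left A B 1
  commutes' c := by
    rw [Algebra.algebraMap_eq_smul_one, Algebra.algebraMap_eq_smul_one, opTensor_smul_left,
      opTensor_one]
  map_star' A := by rw [star_opTensor, star_one]

/-- The embedding `B ↦ 1 ⊗ B` as a star homomorphism. -/
noncomputable def opTensorRight (H : Type*) [NormedAddCommGroup H] [InnerProductSpace ℂ H]
    [CompleteSpace H] : (H →L[ℂ] H) →⋆ₐ[ℂ] (HilbertTensor H →L[ℂ] HilbertTensor H) where
  toFun B := opTensor 1 B
  map_one' := opTensor_one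
  map_mul' A B := by rw [← opTensor_mul, one_mul]
  map_zero' := opTensor_zero_right 1
  map_add' A B := opTensor_add_right 1 A B
  commutes' c := by
    rw [Algebra.algebraMap_eq_smul_one, Algebra.algebraMap_eq_smul_one, opTensor_smul_right,
      opTensor_one]
  map_star' A := by rw [star_opTensor, star_one]

theorem opTensorLeft_apply (A : H →L[ℂ] H) : opTensorLeft H A = opTensor A 1 := rfl

theorem opTensorRight_apply (B : H →L[ℂ] H) : opTensorRight H B = opTensor 1 B := rfl

theorem commute_opTensorLeft_opTensorRight (A B : H →L[ℂ] H) :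
    Commute (opTensorLeft H A) (opTensorRight H B) := by
  rw [Commute, SemiconjBy, opTensorLeft_apply, opTensorRight_apply, ← opTensor_mul,
    ← opTensor_mul, mul_one, one_mul, mul_one, one_mul]

theorem opTensor_eq_mul (A B : H →L[ℂ] H) :
    opTensor A B = opTensorLeft H A * opTensorRight H B := by
  rw [opTensorLeft_apply, opTensorRight_apply, ← opTensor_mul, mul_one, one_mul]

end HilbertTensor

/-! ### The integral inequality -/

theorem theorem5p4
    {H : Type u} [NormedAddCommGroup H] [InnerProductSpace ℂ H] [CompleteSpace H]
    {Ω : Type v} [TopologicalSpace Ω] [LocallyCompactSpace Ω] [T2Space Ω]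
    [MeasurableSpace Ω] [BorelSpace Ω]
    (μ : Measure Ω) [IsFiniteMeasure μ] [μ.Regular]
    (a b : ℝ) (ha : 0 < a) (hab : (1 : ℝ) ∈ Set.Icc a b)
    (A W : Ω → H →L[ℂ] H)
    (hA : Continuous A) (hApos : ∀ t, IsStrictlyPositive (A t))
    (hAspec : ∀ t, spectrum ℝ (A t) ⊆ Set.Icc a b)
    (hW : Continuous W) (hWpos : ∀ t, 0 ≤ W t) (hWint : Integrable (fun t => ‖W t‖) μ)
    (f : ℝ → ℝ) (hf0 : ∀ x, 0 ≤ x → 0 ≤ f x) (hf1 : f 1 = 1)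
    (hfmono : IsOperatorMonotone.{u} f) (hfmul : IsSuperMultiplicative f) :
    Integrable W μ ∧
    Integrable (fun t => CFC.sqrt (W t) * cfc f (A t) * CFC.sqrt (W t)) μ ∧
    Integrable (fun t => CFC.sqrt (W t) * cfc f (Ring.inverse (A t)) * CFC.sqrt (W t)) μ ∧
    symTensor (∫ t, CFC.sqrt (W t) * cfc f (A t) * CFC.sqrt (W t) ∂μ)
        (∫ t, CFC.sqrt (W t) * cfc f (Ring.inverse (A t)) * CFC.sqrt (W t) ∂μ) ≤
      ((a ^ 2 + b ^ 2) / (2 * a * b)) • opTensor (∫ t, W t ∂μ) (∫ t, W t ∂μ) := by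
  have hsa : ∀ t, IsSelfAdjoint (A t) := fun t => (hApos t).nonneg.isSelfAdjoint
  have hKpos : ∀ x ∈ Set.Icc a b, 0 < x := fun x hx => ha.trans_le hx.1
  have hf : ContinuousOn f (Set.Icc a b) := hfmono.1.mono fun x hx => (hKpos x hx).le
  have hfinv : ContinuousOn (fun x => f x⁻¹) (Set.Icc a b) :=
    hfmono.1.comp (continuousOn_id.inv₀ fun x hx => (hKpos x hx).ne')
      fun x hx => (inv_pos.2 (hKpos x hx)).le
  have hinv : ∀ t, cfc f (Ring.inverse (A t)) = cfc (fun x => f x⁻¹) (A t) := fun t => by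
    refine cfc_ringInverse (hsa t) (hApos t).isUnit f (hfmono.1.mono ?_)
    rintro _ ⟨x, hx, rfl⟩
    exact (inv_pos.2 (hKpos x (hAspec t hx))).le
  have hWi : Integrable W μ := (integrable_norm_iff hW.aestronglyMeasurable_of_regular).1 hWint
  have hX := integrable_sqrt_mul_cfc_mul_sqrt hA hsa isCompact_Icc hAspec hW hWpos hWint hf
  have hY := integrable_sqrt_mul_cfc_mul_sqrt hA hsa isCompact_Icc hAspec hW hWpos hWint hfinv
  simp only [hinv]
  refine ⟨hWi, hX, hY, ?_⟩
  have h2 : (a ^ 2 + b ^ 2) / (2 * a * b) = 1 / 2 * ((a ^ 2 + b ^ 2) / (a * b)) := by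
    rw [mul_assoc, div_mul_div_comm, one_mul]
  rw [h2, symTensor, opTensor_eq_mul, opTensor_eq_mul, opTensor_eq_mul]
  have key := half_smul_map_integral_add_le (𝓑 := H →L[ℂ] H)
    (𝓐 := HilbertTensor H →L[ℂ] HilbertTensor H) (opTensorLeft H) (opTensorRight H)
    commute_opTensorLeft_opTensorRight hsa hAspec hWpos hWi hf hfinv hX hY fun x hx y hy =>
      apply_mul_apply_inv_add_le hf0 hf1 hfmono hfmul ha hx hy
  exact key
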